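/- **The Quadratic Concentration Inequality.** For a probability law $F$ on $\mathbb{R}$ write $\kappa_F=\sup_{x\in\mathbb{R}}F(\{x\})$ for its biggest jump, and let $D_F=\{x: F(\{x\})>0\}$ be the set of discontinuities of its distribution function. Let $x_F$ be a point with $F(\{x_F\})=\kappa_F$ and let $\Delta\in(0,1)$. Put $\kappa_{F,\Delta}=\kappa_F$ if $F$ is discrete and $x_F$ is not an accumulation point of $D_F$, and $\kappa_{F,\Delta}=\kappa_F+\Delta$ otherwise; it is always assumed that $\Delta$ is so small that $\kappa_{F,\Delta}<1$ (both $x_F$ and $\Delta$ may depend on $F$). There is a universal constant $C>0$ with the following property. Let $\xi_1,\ldots,\xi_n$ be independent real random variables, none of them almost surely constant, let $(c_{ij})_{1\le i,j\le n}$ be a real array with $c_{ij}=c_{ji}$, and let $S_1\sqcup S_2=\{1,\ldots,n\}$ be a partition with $S_2\neq\emptyset$ such that for each $j\in S_2$ the set $N_j=\{i\in S_1: c_{ij}\neq 0\}$ is non-empty. Let $\kappa(i)$, $\kappa_\Delta(i)$ be the numbers $\kappa_F$, $\kappa_{F,\Delta}$ for the law $F$ of $\xi_i$, and let $\overline{\kappa}(i)$,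 $\overline{\kappa}_\Delta(i)$ be the same numbers for the law of $\xi_i-\xi_i'$, where $\xi_i'$ is an independent copy of $\xi_i$. Then for every $x\in\mathbb{R}$, every such choice of the points $x_F$ and every such choice of the numbers $\Delta$, $$ \Pr\Big\{\sum_{1\le i,j\le n}c_{ij}\xi_i\xi_j=x\Big\}\le C\left[\frac{1}{|S_2|}\sum_{j\in S_2}\frac{\sum_{i\in N_j}(1-\overline{\kappa}(i))\,\overline{\kappa}_\Delta(i)}{\big\{\sum_{i\in N_j}[1-\overline{\kappa}_\Delta(i)]\big\}^{3/2}}+\sup_{D\subset S_2,\ |D|\ge|S_2|/2}\frac{\sum_{j\in D}(1-\kappa(j))\,\kappa_\Delta(j)}{\big\{\sum_{j\in D}[1-\kappa_\Delta(j)]\big\}^{3/2}}\right]^{1/2}. $$ -/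

import Mathlib

open MeasureTheory ProbabilityTheory Filter Topology

/-- A real random variable is non-degenerate if it is not almost surely constant. -/
def IsNondegenerate {Ω : Type*} [MeasurableSpace Ω] (P : Measure Ω) (X : Ω → ℝ) : Prop :=
  ¬ ∃ a : ℝ, ∀ᵐ ω ∂P, X ω = a

/-- The law of `ξ - ξ'`, where `ξ` has law `μ` and `ξ'` is an independent copy of `ξ`. -/
noncomputable def symmetrizedLaw (μ : Measure ℝ) : Measure ℝ :=
  (μ.prod μ).map (fun p : ℝ × ℝ => p.1 - p.2)

/-- The biggest jump `κ = sup_x μ {x}` of the distribution function of `μ`. -/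
noncomputable def biggestJump (μ : Measure ℝ) : ℝ :=
  ⨆ x : ℝ, μ.real {x}

/-- The set `D_F` of discontinuities of the distribution function of `μ`, i.e. its atoms. -/
def jumpSet (μ : Measure ℝ) : Set ℝ :=
  {x | μ {x} ≠ 0}

/-- The distribution `μ` is discrete: it is carried by its (countable) set of atoms. -/
def IsDiscreteLaw (μ : Measure ℝ) : Prop :=
  μ (jumpSet μ)ᶜ = 0

open scoped Classical in
/-- The number `κ_Δ`, for a point `x` at which the biggest jump `κ` is attained and a given `Δ`:
it is `κ` if `μ` is discrete and `x` is not an accumulation point of the set of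
discontinuities, and `κ + Δ` otherwise. -/
noncomputable def jumpLevel (μ : Measure ℝ) (x Δ : ℝ) : ℝ :=
  if IsDiscreteLaw μ ∧ ¬ AccPt x (𝓟 (jumpSet μ)) then biggestJump μ else biggestJump μ + Δ

/-- `k` is an admissible value of `κ_Δ` for the law `μ`: `k = κ_Δ < 1` for some `Δ ∈ (0, 1)` and
some point `x` at which the biggest jump is attained. -/
def IsJumpLevel (μ : Measure ℝ) (k : ℝ) : Prop :=
  k < 1 ∧ ∃ x Δ : ℝ, μ.real {x} = biggestJump μ ∧ 0 < Δ ∧ Δ < 1 ∧ k = jumpLevel μ x Δ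

/-- The linear concentration bound
`∑_{i ∈ s} (1 - κ(i)) κ_Δ(i) / (∑_{i ∈ s} (1 - κ_Δ(i)))^{3/2}`. -/
noncomputable def linearBound {ι : Type*} (s : Finset ι) (κ κΔ : ι → ℝ) : ℝ :=
  (∑ i ∈ s, (1 - κ i) * κΔ i) / (∑ i ∈ s, (1 - κΔ i)) ^ (3 / 2 : ℝ)

/-- The neighbourhood `N_j = {i ∈ S₁ : c_{ij} ≠ 0}`. -/
noncomputable def nbhd {n : ℕ} (c : Fin n → Fin n → ℝ) (S₁ : Finset (Fin n)) (j : Fin n) :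
    Finset (Fin n) :=
  S₁.filter (fun i => c i j ≠ 0)

/-! Keep the coordinates `w` indexed by `S₂` and draw those indexed by `S₁` twice, as `z` and `z'`.
By Jensen, the square of the probability is at most the probability that both `(z, w)` and `(z', w)`
solve the equation (`sq_prod_real_le`). On subtracting, the terms quadratic in `w` cancel, and what
remains is linear in `w` with coefficients `2 a_j`, where `a_j = ∑_{i ∈ N_j} c_ij (z_i - z'_i)`.
Each `a_j` is a linear form in symmetrized variables, so a linear concentration bound controls
`P(a_j = 0)`. By Markov, at least half of the `a_j` vanish only with probability bounded by the
first term; otherwise the linear bound in `w`, over the `j` with `a_j ≠ 0`, gives the second. The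
square root is the price of decoupling.

The linear bound is `real_sum_eq_le_linearBound`. It treats separately the variables with biggest
jump below `1/2` and the others, keeping whichever group carries half of `∑ (1 - κ)`.

For small atoms, a rearrangement argument (`convList_real_finset_le`) shows that among laws with
atoms at most `1/k` the uniform law on `{0, …, k-1}` is extremal. When `k` is a power of two, its
convolution powers are bounded by repeated doubling, starting from binomial coefficients. For large
atoms, each law is a mixture of a point mass and a law with atoms at most `1/2`; an induction over
the mixtures reduces to the case `k = 2`. -/

/-! ### Rearrangement: comparison with uniform laws on integer intervals -/

/-- The number of ways to write `y` as a sum of `n` elements of `{0, …, k - 1}`. -/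
noncomputable def stepCount (k : ℕ) : ℕ → ℤ → ℝ
  | 0, y => if y = 0 then 1 else 0
  | n + 1, y => ∑ t ∈ Finset.range k, stepCount k n (y - t)

/-- The differences along one row and one column of the grid run once through the interval from `a -
k` to `a + m`; the rest is a grid with both sides shorter by one. This is the extremal case of the
decomposition used for real sets below. -/
lemma sum_window_split (g : ℤ → ℝ) (a : ℤ) (m k : ℕ) :
    ∑ i ∈ Finset.range (m + 1), ∑ t ∈ Finset.range (k + 1), g (a + i - t) =
      ∑ i ∈ Finset.range (k + 1 + m), g (a - k + i) +
        ∑ i ∈ Finset.range m, ∑ t ∈ Finset.range k, g (a + i - t) := by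
  have h1 : ∑ t ∈ Finset.range (k + 1), g (a - t) = ∑ i ∈ Finset.range (k + 1), g (a - k + i) := by
    rw [← Finset.sum_range_reflect]
    refine Finset.sum_congr rfl fun i hi => ?_
    have := Finset.mem_range.1 hi
    congr 1
    push_cast [show i ≤ k by omega]
    ring
  rw [Finset.sum_range_succ', Finset.sum_range_add (fun i : ℕ => g (a - k + i))]
  simp only [Nat.cast_zero, add_zero]
  rw [h1]
  have h2 : ∀ i ∈ Finset.range m, ∑ t ∈ Finset.range (k + 1), g (a + ((i + 1 : ℕ) : ℤ) - t) =
      ∑ t ∈ Finset.range k, g (a + i - t) + g (a - k + ((k + 1 + i : ℕ) : ℤ)) := by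
    intro i _
    rw [Finset.sum_range_succ']
    congr 1
    · refine Finset.sum_congr rfl fun t _ => ?_
      congr 1; push_cast; ring
    · congr 1; push_cast; ring
  rw [Finset.sum_congr rfl h2, Finset.sum_add_distrib]
  ring

/-- If the sums of `f` over finite sets of reals are dominated by the sums of `g` over integer
intervals of the same length with a prescribed centre, then so are the sums of the convolution of
`f` with the indicator of a finite set. -/
lemma sum_sum_sub_le_window (f : ℝ → ℝ) (g : ℤ → ℝ) (a : ℤ) (A T : Finset ℝ)
    (h : ∀ (B : Finset ℝ) (b : ℤ), 2 * b + B.card = 2 * a + A.card - T.card + 1 →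
      ∑ x ∈ B, f x ≤ ∑ i ∈ Finset.range B.card, g (b + i)) :
    ∑ x ∈ A, ∑ t ∈ T, f (x - t) ≤
      ∑ i ∈ Finset.range A.card, ∑ t ∈ Finset.range T.card, g (a + i - t) := by
  induction hm : A.card generalizing A T with
  | zero => simp [Finset.card_eq_zero.1 hm]
  | succ m ih =>
    rcases hk : T.card with _ | k
    · simp [Finset.card_eq_zero.1 hk]
    have hA : A.Nonempty := Finset.card_pos.1 (by omega)
    have hT : T.Nonempty := Finset.card_pos.1 (by omega)
    -- Peel off the differences involving `a0` or `t0`. Since `a0 - t ≤ a0 - t0 < x - t0` for `x ≠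
    -- a0`, they are `|A| + |T| - 1` distinct reals, to which `h` applies. Removing one point from
    -- each set keeps `|A| - |T|`, hence the prescribed centre.
    set a0 := A.min' hA with ha0
    set t0 := T.min' hT with ht0
    have ha : a0 ∈ A := A.min'_mem hA
    have ht : t0 ∈ T := T.min'_mem hT
    have hca : (A.erase a0).card = m := by rw [Finset.card_erase_of_mem ha]; omega
    have hct : (T.erase t0).card = k := by rw [Finset.card_erase_of_mem ht]; omega
    have ih' := ih (A.erase a0) (T.erase t0) (by
      intro B b hb
      apply h B b
      rw [hca, hct] at hb
      rw [hm, hk]; push_cast; linarith) hca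
    rw [hct] at ih'
    have hinj1 : Function.Injective fun t : ℝ => a0 - t := fun x y hxy => by simpa using hxy
    have hinj2 : Function.Injective fun x : ℝ => x - t0 := fun x y hxy => by simpa using hxy
    have hdisj : Disjoint (T.image fun t => a0 - t) ((A.erase a0).image fun x => x - t0) := by
      rw [Finset.disjoint_left]
      intro y hy hy'
      obtain ⟨t, htT, rfl⟩ := Finset.mem_image.1 hy
      obtain ⟨x, hx, hxe⟩ := Finset.mem_image.1 hy'
      have h1 : t0 ≤ t := T.min'_le t htT
      have h2 : a0 < x := A.min'_lt_of_mem_erase_min' hA hx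
      linarith
    have hB := h ((T.image fun t => a0 - t) ∪ ((A.erase a0).image fun x => x - t0)) (a - k) (by
      rw [Finset.card_union_of_disjoint hdisj, Finset.card_image_of_injective _ hinj1,
        Finset.card_image_of_injective _ hinj2, hca, hm, hk]
      push_cast; ring)
    rw [Finset.sum_union hdisj, Finset.sum_image (fun x _ y _ hxy => hinj1 hxy),
      Finset.sum_image (fun x _ y _ hxy => hinj2 hxy), Finset.card_union_of_disjoint hdisj,
      Finset.card_image_of_injective _ hinj1,
      Finset.card_image_of_injective _ hinj2, hca, hk] at hB
    rw [sum_window_split, ← Finset.add_sum_erase A _ ha]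
    have h3 : ∑ x ∈ A.erase a0, ∑ t ∈ T, f (x - t) =
        ∑ x ∈ A.erase a0, f (x - t0) + ∑ x ∈ A.erase a0, ∑ t ∈ T.erase t0, f (x - t) := by
      rw [← Finset.sum_add_distrib]
      exact Finset.sum_congr rfl fun x _ => (Finset.add_sum_erase T _ ht).symm
    rw [h3]
    linarith

/-- Greedy choice: finiteness of the upper level sets ensures that a largest remaining value is
attained. -/
lemma exists_card_eq_forall_notMem_le (g : ℝ → ℝ) (h0 : ∀ x, 0 ≤ g x)
    (hfin : ∀ ε > 0, {x | ε ≤ g x}.Finite) (k : ℕ) :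
    ∃ T : Finset ℝ, T.card = k ∧ ∀ t ∈ T, ∀ x ∉ T, g x ≤ g t := by
  induction k with
  | zero => exact ⟨∅, rfl, by simp⟩
  | succ k ih =>
    obtain ⟨T, hT, hg⟩ := ih
    have hy : ∃ y ∉ T, ∀ x ∉ T, g x ≤ g y := by
      by_cases h : ∃ y ∉ T, 0 < g y
      · obtain ⟨y, hyT, hy⟩ := h
        obtain ⟨z, hz, hmax⟩ := ((hfin _ hy).inter_of_left {x | x ∉ T}).exists_maximalFor g _
          ⟨y, le_refl (g y), hyT⟩
        refine ⟨z, hz.2, fun x hx => ?_⟩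
        by_cases hxy : g y ≤ g x
        · by_contra! hlt
          exact absurd (hmax ⟨hxy, hx⟩ hlt.le) (not_le.2 hlt)
        · exact (not_le.1 hxy).le.trans hz.1
      · push Not at h
        obtain ⟨y, hy⟩ := Infinite.exists_notMem_finset T
        exact ⟨y, hy, fun x hx => (h x hx).trans (h0 y)⟩
    obtain ⟨y, hyT, hy⟩ := hy
    refine ⟨insert y T, by simp [hyT, hT], fun t ht x hx => ?_⟩
    rw [Finset.mem_insert, not_or] at hx
    rcases Finset.mem_insert.1 ht with rfl | ht
    · exact hy x hx.2
    · exact hg t ht x hx.2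

/-- An integral against a law whose atoms are at most `1 / k` is at most an average over `k`
points. -/
lemma exists_integral_le_average (μ : Measure ℝ) [IsProbabilityMeasure μ] {k : ℕ} (hk : 0 < k)
    (hμ : ∀ x, μ.real {x} ≤ 1 / k) (g : ℝ → ℝ) (h0 : ∀ x, 0 ≤ g x) (hg : Integrable g μ)
    (hfin : ∀ ε > 0, {x | ε ≤ g x}.Finite) :
    ∃ T : Finset ℝ, T.card = k ∧ ∫ x, g x ∂μ ≤ 1 / k * ∑ t ∈ T, g t := by
  obtain ⟨T, hT, htop⟩ := exists_card_eq_forall_notMem_le g h0 hfin k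
  refine ⟨T, hT, ?_⟩
  -- Bathtub principle: with `g s` the least of the top `k` values, `g` is at most `g s` plus spikes
  -- of height `g t - g s ≥ 0` on `T`, and each spike has mass at most `1 / k`.
  obtain ⟨s, hs, hmin⟩ := T.exists_min_image g (Finset.card_pos.1 (by omega))
  have hint : ∀ t ∈ T, Integrable (({t} : Set ℝ).indicator fun _ => g t - g s) μ := fun t _ =>
    (integrable_const _).indicator (measurableSet_singleton t)
  have hle : ∀ x, g x ≤ g s + ∑ t ∈ T, ({t} : Set ℝ).indicator (fun _ => g t - g s) x := by
    intro x
    by_cases hx : x ∈ T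
    · rw [Finset.sum_eq_single x]
      · simp
      · intro b _ hb; simp [Ne.symm hb]
      · exact fun h => absurd hx h
    · rw [Finset.sum_eq_zero]
      · simpa using htop s hs x hx
      · intro t ht
        have : x ≠ t := fun h => hx (h ▸ ht)
        simp [this]
  calc ∫ x, g x ∂μ
      ≤ ∫ x, (g s + ∑ t ∈ T, ({t} : Set ℝ).indicator (fun _ => g t - g s) x) ∂μ :=
        integral_mono hg ((integrable_const _).add (integrable_finsetSum _ hint)) hle
    _ = g s + ∑ t ∈ T, μ.real {t} * (g t - g s) := by
        rw [integral_add (integrable_const _) (integrable_finsetSum _ hint),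
          integral_finsetSum _ hint]
        simp only [integral_indicator_const _ (measurableSet_singleton _), integral_const,
          probReal_univ, smul_eq_mul, one_mul]
    _ ≤ g s + ∑ t ∈ T, 1 / k * (g t - g s) := by
        gcongr with t ht
        · exact sub_nonneg.2 (hmin t ht)
        · exact hμ t
    _ = 1 / k * ∑ t ∈ T, g t := by
        have : (k : ℝ) ≠ 0 := by positivity
        rw [← Finset.mul_sum, Finset.sum_sub_distrib, Finset.sum_const, hT, nsmul_eq_mul]
        field_simp
        ring

lemma conv_real_finset (μ ν : Measure ℝ) [IsProbabilityMeasure μ] [IsProbabilityMeasure ν]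
    (A : Finset ℝ) : (μ.conv ν).real A = ∫ x, ∑ a ∈ A, ν.real {a - x} ∂μ := by
  have hA : MeasurableSet (A : Set ℝ) := A.measurableSet
  rw [Measure.conv, map_measureReal_apply measurable_add hA, measureReal_def,
    Measure.prod_apply (measurable_add hA), ← integral_toReal]
  · refine integral_congr_ae (ae_of_all _ fun x => ?_)
    have : Prod.mk x ⁻¹' ((fun x : ℝ × ℝ => x.1 + x.2) ⁻¹' (A : Set ℝ)) =
        ((A.image fun a => a - x : Finset ℝ) : Set ℝ) := by
      ext y
      simp only [Set.mem_preimage, Finset.coe_image, Set.mem_image]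
      constructor
      · intro h; exact ⟨x + y, h, by ring⟩
      · rintro ⟨a, ha, rfl⟩; simpa using ha
    dsimp only
    rw [this, ← measureReal_def, ← sum_measureReal_singleton, Finset.sum_image]
    intro a _ b _ hab
    simpa using hab
  · exact (measurable_measure_prodMk_left (measurable_add hA)).aemeasurable
  · exact ae_of_all _ fun x => measure_lt_top _ _

lemma integrable_sum_real_singleton (μ ν : Measure ℝ) [IsProbabilityMeasure μ]
    [IsProbabilityMeasure ν] (A : Finset ℝ) :
    Integrable (fun x => ∑ a ∈ A, ν.real {a - x}) μ := by
  refine integrable_finsetSum _ fun a _ => ?_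
  have hm : Measurable fun x => ν {a - x} := by
    have h := measurable_measure_prodMk_left (ν := ν)
      (measurable_add (measurableSet_singleton a) : MeasurableSet ((fun x : ℝ × ℝ => x.1 + x.2) ⁻¹' {a}))
    convert h using 2 with x
    congr 1
    ext y
    simp only [Set.mem_singleton_iff, Set.mem_preimage]
    constructor <;> intro h <;> linarith
  refine Integrable.of_bound (C := 1) hm.ennreal_toReal.aestronglyMeasurable
    (ae_of_all _ fun x => ?_)
  rw [Real.norm_of_nonneg measureReal_nonneg]
  exact measureReal_le_one

/-- For each `a` the masses at the distinct points `a - x` add up to at most one, so at most `|A| /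
ε` values of `x` qualify. -/
lemma finite_le_sum_real_singleton (ν : Measure ℝ) [IsProbabilityMeasure ν] (A : Finset ℝ)
    {ε : ℝ} (hε : 0 < ε) : {x | ε ≤ ∑ a ∈ A, ν.real {a - x}}.Finite := by
  by_contra hinf
  obtain ⟨N, hN⟩ := exists_nat_gt (A.card / ε)
  obtain ⟨F, hF, hcard⟩ := Set.Infinite.exists_subset_card_eq hinf N
  have h1 : (N : ℝ) * ε ≤ ∑ x ∈ F, ∑ a ∈ A, ν.real {a - x} := by
    rw [← hcard, ← nsmul_eq_mul]
    exact Finset.card_nsmul_le_sum _ _ _ fun x hx => hF hx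
  rw [Finset.sum_comm] at h1
  have h2 : ∑ a ∈ A, ∑ x ∈ F, ν.real {a - x} ≤ ∑ a ∈ A, 1 := by
    refine Finset.sum_le_sum fun a _ => ?_
    have : ∑ x ∈ F, ν.real {a - x} = ν.real ((F.image fun x => a - x : Finset ℝ) : Set ℝ) := by
      rw [← sum_measureReal_singleton, Finset.sum_image]
      intro x _ y _ hxy
      simpa using hxy
    rw [this]
    exact measureReal_le_one
  rw [div_lt_iff₀ hε] at hN
  simp at h2
  linarith

/-- The convolution of a list of measures. -/
noncomputable def convList : List (Measure ℝ) → Measure ℝ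
  | [] => Measure.dirac 0
  | μ :: L => μ.conv (convList L)

lemma isProbabilityMeasure_convList {L : List (Measure ℝ)}
    (hL : ∀ μ ∈ L, IsProbabilityMeasure μ) : IsProbabilityMeasure (convList L) := by
  induction L with
  | nil => exact Measure.dirac.isProbabilityMeasure
  | cons μ L ih =>
    have := hL μ (by simp)
    have := ih fun ν hν => hL ν (by simp [hν])
    exact inferInstanceAs (IsProbabilityMeasure (μ.conv (convList L)))

/-- Among sums of independent variables with atoms at most `1 / k`, the uniform law on an
arithmetic progression of length `k` is the most concentrated. -/
lemma convList_real_finset_le {k : ℕ} (hk : 0 < k) (L : List (Measure ℝ))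
    (hL : ∀ μ ∈ L, IsProbabilityMeasure μ) (hat : ∀ μ ∈ L, ∀ x, μ.real {x} ≤ 1 / k)
    (A : Finset ℝ) (a : ℤ) (ha : 2 * a + A.card = L.length * (k - 1) + 1) :
    (convList L).real A ≤
      (1 / k : ℝ) ^ L.length * ∑ i ∈ Finset.range A.card, stepCount k L.length (a + i) := by
  induction L generalizing A a with
  | nil =>
    have h1 : (convList []).real A ≤ 1 := by
      have := isProbabilityMeasure_convList hL
      exact measureReal_le_one
    refine h1.trans ?_
    simp only [List.length_nil, Nat.cast_zero, zero_mul, zero_add] at ha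
    simp only [List.length_nil, pow_zero, one_mul, stepCount]
    -- Here `2 * a + |A| = 1`, so the window is centred at `0` and contains it, at index `-a`.
    have h2 := Finset.single_le_sum (f := fun i : ℕ => if a + (i : ℤ) = 0 then (1 : ℝ) else 0)
      (s := Finset.range A.card) (fun i _ => by split_ifs <;> norm_num)
      (a := (-a).toNat) (Finset.mem_range.2 (by omega))
    refine le_trans ?_ h2
    rw [if_pos (by omega)]
  | cons μ L ih =>
    have hμ := hL μ (by simp)
    have hL' : ∀ ν ∈ L, IsProbabilityMeasure ν := fun ν hν => hL ν (by simp [hν])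
    have := isProbabilityMeasure_convList hL'
    obtain ⟨T, hT, hle⟩ := exists_integral_le_average μ hk (hat μ (by simp))
      (fun x => ∑ a ∈ A, (convList L).real {a - x})
      (fun x => Finset.sum_nonneg fun _ _ => measureReal_nonneg)
      (integrable_sum_real_singleton μ _ A) (fun ε hε => finite_le_sum_real_singleton _ A hε)
    -- Dropping one summand moves the centre of the window by `(k - 1) / 2`, which is the shift that
    -- the rearrangement step prescribes for `|T| = k`.
    have key := sum_sum_sub_le_window (fun x => (convList L).real {x})
      (fun y => (1 / k : ℝ) ^ L.length * stepCount k L.length y) a A T (by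
        intro B b hb
        rw [sum_measureReal_singleton, ← Finset.mul_sum]
        refine ih hL' (fun ν hν => hat ν (by simp [hν])) B b ?_
        rw [hb, hT]
        simp only [List.length_cons] at ha
        push_cast at ha
        linarith)
    rw [convList, conv_real_finset]
    refine hle.trans ?_
    rw [Finset.sum_comm]
    refine (mul_le_mul_of_nonneg_left key (by positivity)).trans (le_of_eq ?_)
    simp only [List.length_cons, stepCount, hT, ← Finset.mul_sum]
    ring

/-! ### Largest coefficients of powers of geometric sums -/

open Polynomial in
lemma stepCount_eq_coeff (k n : ℕ) (y : ℤ) :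
    stepCount k n y =
      if 0 ≤ y then ((∑ i ∈ Finset.range k, (X : ℝ[X]) ^ i) ^ n).coeff y.toNat else 0 := by
  induction n generalizing y with
  | zero =>
    simp only [stepCount, pow_zero, coeff_one]
    split_ifs <;> first | rfl | omega
  | succ n ih =>
    simp only [stepCount, ih]
    rw [pow_succ, Finset.mul_sum, finsetSum_coeff]
    split_ifs with hy
    · refine Finset.sum_congr rfl fun i _ => ?_
      rw [coeff_mul_X_pow']
      by_cases h : 0 ≤ y - (i : ℤ)
      · rw [if_pos h, if_pos (by omega)]
        congr 1
        omega
      · rw [if_neg h, if_neg (by omega)]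
    · exact Finset.sum_eq_zero fun i _ => if_neg (by omega)

/-- By Pascal's rule each entry of row `n + 1` is the sum of two neighbours in row `n`, so every
other entry of row `n + 1` exhausts row `n`. -/
lemma sum_antidiagonal_choose_parity (n y : ℕ) :
    ∑ p ∈ Finset.HasAntidiagonal.antidiagonal y, (if 2 ∣ p.1 then (n + 1).choose p.2 else 0) =
      ∑ j ∈ Finset.range (y + 1), n.choose j := by
  induction y using Nat.twoStepInduction with
  | zero => simp
  | one => simp [Finset.Nat.antidiagonal_succ, Finset.sum_range_succ, add_comm]
  | more y ih _ =>
    rw [Finset.Nat.sum_antidiagonal_succ, Finset.Nat.sum_antidiagonal_succ]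
    have h : ∀ p : ℕ × ℕ, (2 ∣ p.1 + 1 + 1) = (2 ∣ p.1) := fun p => by
      apply propext; omega
    simp only [h]
    rw [ih, Finset.sum_range_succ _ (y + 2), Finset.sum_range_succ _ (y + 1),
      Nat.choose_succ_succ]
    simp
    ring

lemma sum_antidiagonal_choose_parity_le (n y : ℕ) :
    ∑ p ∈ Finset.HasAntidiagonal.antidiagonal y, (if 2 ∣ p.1 then (n + 1).choose p.2 else 0) ≤ 2 ^ n := by
  rw [sum_antidiagonal_choose_parity, ← Nat.sum_range_choose]
  refine Finset.sum_le_sum_of_ne_zero fun j _ hj => ?_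
  by_contra h
  exact hj (Nat.choose_eq_zero_of_lt (by simpa using h))

-- With `G_k = 1 + X + ⋯ + X^(k-1)` one has `G_{2k}(X) = G_k(X²) (1 + X)`. Only even exponents come
-- from the first factor, so the binomial coefficients that enter have one parity and sum to at most
-- `2 ^ n`.
open Polynomial in
lemma coeff_geom_pow_double_le (k n : ℕ) {M : ℝ} (hM0 : 0 ≤ M)
    (hM : ∀ y, ((∑ i ∈ Finset.range k, (X : ℝ[X]) ^ i) ^ (n + 1)).coeff y ≤ M) (y : ℕ) :
    ((∑ i ∈ Finset.range (k * 2), (X : ℝ[X]) ^ i) ^ (n + 1)).coeff y ≤ M * 2 ^ n := by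
  have h : ∑ i ∈ Finset.range (k * 2), (X : ℝ[X]) ^ i =
      expand ℝ 2 (∑ i ∈ Finset.range k, (X : ℝ[X]) ^ i) * (1 + X) := by
    clear hM
    simp only [map_sum, map_pow, expand_X]
    induction k with
    | zero => simp
    | succ k ih =>
      rw [show (k + 1) * 2 = k * 2 + 1 + 1 by ring, Finset.sum_range_succ,
        Finset.sum_range_succ, Finset.sum_range_succ _ k, add_mul, ← ih]
      ring
  rw [h, mul_pow, ← map_pow, coeff_mul]
  calc ∑ p ∈ Finset.HasAntidiagonal.antidiagonal y, (expand ℝ 2 ((∑ i ∈ Finset.range k, (X : ℝ[X]) ^ i) ^ (n + 1))).coeff p.1 *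
          ((1 + X : ℝ[X]) ^ (n + 1)).coeff p.2
      ≤ ∑ p ∈ Finset.HasAntidiagonal.antidiagonal y,
          M * ((if 2 ∣ p.1 then (n + 1).choose p.2 else 0 : ℕ) : ℝ) := by
        refine Finset.sum_le_sum fun p _ => ?_
        rw [coeff_expand two_pos, coeff_one_add_X_pow]
        split_ifs
        · exact mul_le_mul_of_nonneg_right (hM _) (Nat.cast_nonneg _)
        · simp
    _ ≤ M * 2 ^ n := by
        rw [← Finset.mul_sum, ← Nat.cast_sum]
        gcongr
        exact_mod_cast sum_antidiagonal_choose_parity_le n y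

open Polynomial in
lemma coeff_geom_two_pow_le (r n y : ℕ) :
    ((∑ i ∈ Finset.range (2 ^ (r + 1)), (X : ℝ[X]) ^ i) ^ (n + 1)).coeff y ≤
      (n + 1).choose ((n + 1) / 2) * (2 ^ n) ^ r := by
  induction r generalizing y with
  | zero =>
    simp only [zero_add, pow_one, pow_zero, mul_one]
    rw [Finset.sum_range_succ, Finset.sum_range_one, pow_zero, pow_one, coeff_one_add_X_pow]
    exact_mod_cast Nat.choose_le_middle y (n + 1)
  | succ r ih =>
    rw [pow_succ 2 (r + 1), pow_succ (2 ^ n : ℝ) r, ← mul_assoc]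
    exact coeff_geom_pow_double_le _ n (by positivity) ih y

lemma stepCount_two_pow_le (r n : ℕ) (y : ℤ) :
    stepCount (2 ^ (r + 1)) (n + 1) y ≤ (n + 1).choose ((n + 1) / 2) * (2 ^ n) ^ r := by
  rw [stepCount_eq_coeff]
  split_ifs
  · exact coeff_geom_two_pow_le r n _
  · positivity

/-- The factor `2 * n + 1` closes the induction, because `(2n + 1)(2n + 3) ≤ 4 (n + 1)²`. -/
lemma centralBinom_sq_mul_le (n : ℕ) : n.centralBinom ^ 2 * (2 * n + 1) ≤ 16 ^ n := by
  induction n with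
  | zero => simp
  | succ n ih =>
    have h := Nat.succ_mul_centralBinom_succ n
    have h1 : (n + 1) ^ 2 * ((n + 1).centralBinom ^ 2 * (2 * (n + 1) + 1)) ≤
        (n + 1) ^ 2 * 16 ^ (n + 1) := by
      calc (n + 1) ^ 2 * ((n + 1).centralBinom ^ 2 * (2 * (n + 1) + 1))
          = ((n + 1) * (n + 1).centralBinom) ^ 2 * (2 * (n + 1) + 1) := by ring
        _ = (n.centralBinom ^ 2 * (2 * n + 1)) * (4 * ((2 * n + 1) * (2 * n + 3))) := by
            rw [h]; ring
        _ ≤ 16 ^ n * (4 * (4 * (n + 1) ^ 2)) := by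
            exact Nat.mul_le_mul ih (by nlinarith)
        _ = (n + 1) ^ 2 * 16 ^ (n + 1) := by ring
    exact Nat.le_of_mul_le_mul_left h1 (by positivity)

lemma choose_half_sq_mul_le (n : ℕ) : n.choose (n / 2) ^ 2 * (n + 1) ≤ 4 ^ n := by
  rcases Nat.even_or_odd' n with ⟨m, rfl | rfl⟩
  · have := centralBinom_sq_mul_le m
    rw [Nat.centralBinom_eq_two_mul_choose] at this
    rw [Nat.mul_div_cancel_left m two_pos, pow_mul]
    exact this
  · have := centralBinom_sq_mul_le (m + 1)
    have h2 : (m + 1).centralBinom = 2 * (2 * m + 1).choose m := by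
      rw [Nat.centralBinom_eq_two_mul_choose, show 2 * (m + 1) = 2 * m + 1 + 1 by ring,
        Nat.choose_succ_succ, Nat.choose_symm_half]
      ring
    rw [h2] at this
    rw [show (2 * m + 1) / 2 = m by omega]
    have h3 : (4 : ℕ) ^ (2 * m + 1) * 4 = 16 ^ (m + 1) := by
      rw [← pow_succ, show 2 * m + 1 + 1 = 2 * (m + 1) by ring, pow_mul]
      norm_num
    nlinarith

lemma choose_half_le (n : ℕ) : (n.choose (n / 2) : ℝ) ≤ 2 ^ n / √(n + 1) := by
  have h : ((n.choose (n / 2) : ℝ)) ^ 2 * (n + 1) ≤ 4 ^ n := by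
    exact_mod_cast choose_half_sq_mul_le n
  rw [le_div_iff₀ (by positivity)]
  refine le_of_sq_le_sq ?_ (by positivity)
  rw [mul_pow, Real.sq_sqrt (by positivity), ← pow_mul, mul_comm n 2, pow_mul]
  norm_num
  exact h

/-- The atoms of a sum of `n` independent variables whose atoms are at most `2 ^ (-(r + 1))`. -/
lemma convList_real_singleton_le (r : ℕ) (L : List (Measure ℝ)) (hne : L ≠ [])
    (hL : ∀ μ ∈ L, IsProbabilityMeasure μ)
    (hat : ∀ μ ∈ L, ∀ x, μ.real {x} ≤ 1 / 2 ^ (r + 1)) (x : ℝ) :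
    (convList L).real {x} ≤ 4 * (1 / 2 ^ (r + 1)) / √(L.length + 1) := by
  have := isProbabilityMeasure_convList hL
  obtain ⟨n, hn⟩ : ∃ n, L.length = n + 1 :=
    Nat.exists_eq_succ_of_ne_zero (by simpa using hne)
  -- The centre condition forces the parity of `|A|`, so a second point may have to be added to
  -- `{x}`; this costs a factor `2`.
  obtain ⟨A, a, hxA, hA2, ha⟩ : ∃ (A : Finset ℝ) (a : ℤ), x ∈ A ∧ A.card ≤ 2 ∧
      2 * a + A.card = L.length * (((2 ^ (r + 1) : ℕ) : ℤ) - 1) + 1 := by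
    rcases Int.even_or_odd' ((L.length : ℤ) * (((2 ^ (r + 1) : ℕ) : ℤ) - 1)) with ⟨b, hb | hb⟩
    · exact ⟨{x}, b, by simp, by simp, by rw [hb]; simp⟩
    · refine ⟨{x, x + 1}, b, by simp, Finset.card_le_two, ?_⟩
      rw [hb, Finset.card_pair (by simp)]
      push_cast; ring
  have h1 := convList_real_finset_le (k := 2 ^ (r + 1)) (by positivity) L hL
    (by simpa using hat) A a ha
  have h2 : (convList L).real {x} ≤ (convList L).real A :=
    measureReal_mono (by simpa using hxA)
  refine (h2.trans h1).trans ?_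
  have h3 : ∑ i ∈ Finset.range A.card, stepCount (2 ^ (r + 1)) L.length (a + i) ≤
      2 * ((2 ^ L.length / √(L.length + 1)) * (2 ^ n) ^ r) := by
    calc _ ≤ ∑ i ∈ Finset.range A.card, (2 ^ L.length / √(L.length + 1)) * (2 ^ n : ℝ) ^ r := by
          refine Finset.sum_le_sum fun i _ => ?_
          rw [hn]
          refine (stepCount_two_pow_le r n _).trans ?_
          gcongr
          exact choose_half_le (n + 1)
      _ ≤ _ := by
          rw [Finset.sum_const, nsmul_eq_mul]
          rw [Finset.card_range]
          gcongr
          exact_mod_cast hA2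
  refine (mul_le_mul_of_nonneg_left h3 (by positivity)).trans (le_of_eq ?_)
  rw [hn]
  have : √(((n + 1 : ℕ) : ℝ) + 1) ≠ 0 := by positivity
  have h4 : ((2 : ℝ) ^ (r + 1)) ^ (n + 1) = 2 ^ (n + 1) * (2 ^ n) ^ r * 2 ^ r := by
    simp only [← pow_mul, ← pow_add]
    congr 1
    ring
  push_cast
  rw [one_div_pow, h4, pow_succ (2 : ℝ) r]
  field_simp
  norm_num

/-! ### Laws with a large atom -/

lemma real_singleton_le_biggestJump (μ : Measure ℝ) [IsProbabilityMeasure μ] (x : ℝ) :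
    μ.real {x} ≤ biggestJump μ :=
  le_ciSup (f := fun x : ℝ => μ.real {x}) ⟨1, by rintro _ ⟨y, rfl⟩; exact measureReal_le_one⟩ x

lemma biggestJump_nonneg (μ : Measure ℝ) : 0 ≤ biggestJump μ :=
  Real.iSup_nonneg fun _ => measureReal_nonneg

/-- A law with an atom of mass at least `1 / 2` is a mixture of a point mass and of a law all of
whose atoms are at most `1 / 2`. -/
lemma exists_mixture (μ : Measure ℝ) [IsProbabilityMeasure μ] (a : ℝ) (h1 : μ.real {a} < 1) :
    ∃ ρ : Measure ℝ, IsProbabilityMeasure ρ ∧ (∀ x, ρ.real {x} ≤ 1 / 2) ∧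
      ∀ g : ℝ → ℝ, Integrable g μ →
        ∫ x, g x ∂μ = (2 * μ.real {a} - 1) * g a + 2 * (1 - μ.real {a}) * ∫ x, g x ∂ρ := by
  set q := 1 - μ.real {a} with hq
  have hq0 : 0 < q := sub_pos.2 h1
  have hqc : μ.real {a}ᶜ = q := by
    rw [measureReal_compl (measurableSet_singleton a), probReal_univ]
  have hval : ∀ s, MeasurableSet s →
      (ENNReal.ofReal (1 / 2) • Measure.dirac a +
        ENNReal.ofReal (1 / (2 * q)) • μ.restrict {a}ᶜ : Measure ℝ).real s =
        1 / 2 * (Measure.dirac a : Measure ℝ).real s + 1 / (2 * q) * μ.real (s ∩ {a}ᶜ) := by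
    intro s hs
    rw [measureReal_add_apply (ENNReal.mul_ne_top ENNReal.ofReal_ne_top (measure_ne_top _ _))
        (ENNReal.mul_ne_top ENNReal.ofReal_ne_top (measure_ne_top _ _)),
      measureReal_ennreal_smul_apply, measureReal_ennreal_smul_apply,
      ENNReal.toReal_ofReal (by norm_num), ENNReal.toReal_ofReal (by positivity),
      measureReal_restrict_apply hs]
  -- Half of the mass of `ρ` sits at `a`; the other half is `μ` off `a`, normalized by its total
  -- mass `q`.
  refine ⟨ENNReal.ofReal (1 / 2) • Measure.dirac a +
    ENNReal.ofReal (1 / (2 * q)) • μ.restrict {a}ᶜ, ?_, ?_, ?_⟩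
  · refine ⟨?_⟩
    have h := hval Set.univ MeasurableSet.univ
    rw [Set.univ_inter, hqc, probReal_univ (μ := Measure.dirac a)] at h
    have h2 : 1 / 2 * 1 + 1 / (2 * q) * q = 1 := by field_simp; norm_num
    rw [h2, measureReal_def] at h
    exact (ENNReal.toReal_eq_one_iff _).1 h
  · intro x
    rw [hval _ (measurableSet_singleton x)]
    by_cases hx : x = a
    · subst hx
      simp
    · have h3 : (Measure.dirac a : Measure ℝ).real {x} = 0 := by
        simp [measureReal_def, Ne.symm hx]
      have h4 : μ.real ({x} ∩ {a}ᶜ) ≤ q := by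
        rw [← hqc]
        exact measureReal_mono Set.inter_subset_right
      rw [h3, mul_zero, zero_add, div_mul_eq_mul_div, one_mul, div_le_iff₀ (by positivity)]
      linarith
  · intro g hg
    have hgr := hg.integrableOn (s := {a}ᶜ)
    rw [integral_add_measure ((integrable_dirac (by simp)).smul_measure (by simp))
      (hgr.integrable.smul_measure (by simp)), integral_smul_measure, integral_smul_measure,
      integral_dirac, ENNReal.toReal_ofReal (by norm_num), ENNReal.toReal_ofReal (by positivity),
      ← integral_add_compl (measurableSet_singleton a) hg, integral_singleton]
    simp only [smul_eq_mul]
    have : μ.real {a} = 1 - q := by rw [hq]; ring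
    rw [this]
    field_simp
    ring

/-- One mixture step: `v` grows by `1` with probability `p`, and the average of `2 / √v` behaves as
if `v` had grown by `p / 4`. For `v ≥ 1` the unit growth gains a factor `1 - 1 / (4v)`, and `1 - e ≤
1 / √(1 + e)` with `e = p / (4v)` finishes. -/
lemma mixture_inv_sqrt_le {v p : ℝ} (hv : 1 ≤ v) (hp0 : 0 ≤ p) (hp1 : p ≤ 1) :
    (1 - p) * (2 / √v) + p * (2 / √(v + 1)) ≤ 2 / √(v + p / 4) := by
  have hv0 : 0 < v := by linarith
  have hs : 0 < √v := Real.sqrt_pos.2 hv0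
  have e0 : 1 / (4 * v) ≤ 1 := by rw [div_le_one (by positivity)]; linarith
  have h1 : √v ≤ (1 - 1 / (4 * v)) * √(v + 1) := by
    refine le_of_sq_le_sq ?_ (mul_nonneg (sub_nonneg.2 e0) (Real.sqrt_nonneg _))
    rw [mul_pow, Real.sq_sqrt hv0.le, Real.sq_sqrt (by linarith)]
    have : (1 - 1 / (4 * v)) ^ 2 * (v + 1) - v = (8 * v ^ 2 - 7 * v + 1) / (16 * v ^ 2) := by
      field_simp
      ring
    have h : 0 ≤ (8 * v ^ 2 - 7 * v + 1) / (16 * v ^ 2) := by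
      apply div_nonneg _ (by positivity)
      nlinarith
    linarith
  have h1' : 2 / √(v + 1) ≤ (1 - 1 / (4 * v)) * (2 / √v) := by
    have : 0 < √(v + 1) := Real.sqrt_pos.2 (by linarith)
    rw [mul_div_assoc', div_le_div_iff₀ this hs]
    nlinarith
  have h2 : (1 - p / (4 * v)) * √(v + p / 4) ≤ √v := by
    refine le_of_sq_le_sq ?_ hs.le
    rw [mul_pow, Real.sq_sqrt hv0.le, Real.sq_sqrt (by linarith)]
    set e := p / (4 * v) with he
    have he0 : 0 ≤ e := by positivity
    have he1 : e ≤ 1 := by rw [he, div_le_one (by positivity)]; linarith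
    have h3 : v + p / 4 = v * (1 + e) := by rw [he]; field_simp
    rw [h3]
    have : (1 - e) ^ 2 * (1 + e) ≤ 1 := by nlinarith [mul_nonneg he0 he0]
    nlinarith
  have h2' : (1 - p / (4 * v)) * (2 / √v) ≤ 2 / √(v + p / 4) := by
    have : 0 < √(v + p / 4) := Real.sqrt_pos.2 (by linarith)
    rw [mul_div_assoc', div_le_div_iff₀ hs this]
    nlinarith
  calc (1 - p) * (2 / √v) + p * (2 / √(v + 1))
      ≤ (1 - p) * (2 / √v) + p * ((1 - 1 / (4 * v)) * (2 / √v)) := by gcongr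
    _ = (1 - p / (4 * v)) * (2 / √v) := by field_simp; ring
    _ ≤ _ := h2'

lemma conv_real_singleton (μ ν : Measure ℝ) [IsProbabilityMeasure μ] [IsProbabilityMeasure ν]
    (x : ℝ) : (μ.conv ν).real {x} = ∫ y, ν.real {x - y} ∂μ := by
  simpa using conv_real_finset μ ν {x}

lemma integrable_real_singleton (μ ν : Measure ℝ) [IsProbabilityMeasure μ]
    [IsProbabilityMeasure ν] (x : ℝ) : Integrable (fun y => ν.real {x - y}) μ := by
  simpa using integrable_sum_real_singleton μ ν {x}

lemma conv_real_singleton_le (μ ν : Measure ℝ) [IsProbabilityMeasure μ] [IsProbabilityMeasure ν]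
    {M : ℝ} (hM : ∀ x, ν.real {x} ≤ M) (x : ℝ) : (μ.conv ν).real {x} ≤ M := by
  rw [conv_real_singleton]
  calc ∫ y, ν.real {x - y} ∂μ ≤ ∫ _, M ∂μ :=
        integral_mono (integrable_real_singleton μ ν x) (integrable_const _) fun y => hM _
    _ = M := by simp

/-- The Kolmogorov–Rogozin inequality for atoms, for a sum of variables with large atoms and of
variables with atoms at most `1 / 2`. -/
lemma conv_convList_real_singleton_le (L L' : List (Measure ℝ))
    (hL : ∀ μ ∈ L, IsProbabilityMeasure μ)
    (hat : ∀ μ ∈ L, 1 / 2 ≤ biggestJump μ ∧ biggestJump μ < 1 ∧ ∃ a, μ.real {a} = biggestJump μ)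
    (hL' : ∀ μ ∈ L', IsProbabilityMeasure μ) (hat' : ∀ μ ∈ L', ∀ x, μ.real {x} ≤ 1 / 2) (x : ℝ) :
    ((convList L).conv (convList L')).real {x} ≤
      2 / √(L'.length + 1 + (L.map fun μ => (1 - biggestJump μ) / 2).sum) := by
  induction L generalizing L' x with
  | nil =>
    have := isProbabilityMeasure_convList hL'
    simp only [convList, Measure.dirac_zero_conv, List.map_nil, List.sum_nil, add_zero]
    rcases eq_or_ne L' [] with rfl | hne
    · simp only [List.length_nil, Nat.cast_zero, zero_add, Real.sqrt_one]
      exact measureReal_le_one.trans (by norm_num)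
    · have := convList_real_singleton_le 0 L' hne hL' (by simpa using hat') x
      norm_num at this ⊢
      exact this
  | cons μ L ih =>
    have hμ := hL μ (by simp)
    obtain ⟨hh, h1, a, ha⟩ := hat μ (by simp)
    have hL1 : ∀ ν ∈ L, IsProbabilityMeasure ν := fun ν hν => hL ν (by simp [hν])
    have hat1 : ∀ ν ∈ L, _ := fun ν hν => hat ν (List.mem_cons_of_mem _ hν)
    have hp := isProbabilityMeasure_convList hL1
    have hp' := isProbabilityMeasure_convList hL'
    -- The point mass only shifts `x`, while `ρ` joins `L'`; this is why `L'` varies in the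
    -- induction.
    obtain ⟨ρ, hρ, hρat, hmix⟩ := exists_mixture μ a (ha.trans_lt h1)
    rw [convList, Measure.conv_assoc, conv_real_singleton,
      hmix _ (integrable_real_singleton _ _ x), ← conv_real_singleton, ha]
    have e : ρ.conv ((convList L).conv (convList L')) =
        (convList L).conv (convList (ρ :: L')) := by
      rw [convList, ← Measure.conv_assoc, ← Measure.conv_assoc, Measure.conv_comm ρ]
    rw [e]
    have b1 := ih L' hL1 hat1 hL' hat' (x - a)
    have b2 := ih (ρ :: L') hL1 hat1 (by simpa using ⟨hρ, hL'⟩) (by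
      intro ν hν
      rcases List.mem_cons.1 hν with rfl | hν
      · exact hρat
      · exact hat' ν hν) x
    set S := (L.map fun μ => (1 - biggestJump μ) / 2).sum with hS
    have hS0 : 0 ≤ S := by
      refine List.sum_nonneg fun y hy => ?_
      obtain ⟨ν, hν, rfl⟩ := List.mem_map.1 hy
      linarith [(hat1 ν hν).2.1]
    have hmain := mixture_inv_sqrt_le (v := L'.length + 1 + S) (p := 2 * (1 - biggestJump μ))
      (by have : (0 : ℝ) ≤ L'.length := Nat.cast_nonneg _
          linarith) (by linarith) (by linarith)
    rw [List.map_cons, List.sum_cons, ← hS]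
    simp only [List.length_cons, Nat.cast_add, Nat.cast_one] at b2
    calc _ ≤ (2 * biggestJump μ - 1) * (2 / √(L'.length + 1 + S)) +
          2 * (1 - biggestJump μ) * (2 / √(L'.length + 1 + 1 + S)) := by
          gcongr
          linarith
      _ = (1 - 2 * (1 - biggestJump μ)) * (2 / √(L'.length + 1 + S)) +
          2 * (1 - biggestJump μ) * (2 / √(L'.length + 1 + S + 1)) := by
          ring_nf
      _ ≤ _ := hmain
      _ = _ := by ring_nf

/-! ### Transfer to sums of independent random variables -/

section SumLaw

variable {ι Ω : Type*} [MeasurableSpace Ω] {P : Measure Ω} {Y : ι → Ω → ℝ}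

lemma real_sum_eq_eq_map (hY : ∀ i, Measurable (Y i)) (s : Finset ι) (x : ℝ) :
    P.real {ω | ∑ i ∈ s, Y i ω = x} = (P.map (fun ω => ∑ i ∈ s, Y i ω)).real {x} := by
  rw [map_measureReal_apply (Finset.measurable_sum _ fun i _ => hY i) (measurableSet_singleton x)]
  rfl

variable [IsProbabilityMeasure P]

lemma map_sum_eq_convList (hY : ∀ i, Measurable (Y i)) (hind : iIndepFun Y P) (s : Finset ι) :
    P.map (fun ω => ∑ i ∈ s, Y i ω) = convList (s.toList.map fun i => P.map (Y i)) := by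
  classical
  have key : ∀ l : List ι, l.Nodup →
      P.map (fun ω => ∑ i ∈ l.toFinset, Y i ω) = convList (l.map fun i => P.map (Y i)) := by
    intro l hl
    induction l with
    | nil => simp [convList]
    | cons i l ih =>
      obtain ⟨hi, hl⟩ := List.nodup_cons.1 hl
      have hi' : i ∉ l.toFinset := by simpa using hi
      have h := (hind.indepFun_finsetSum_of_notMem hY hi').symm
      rw [List.map_cons, convList, ← ih hl]
      have e2 : (fun ω => ∑ j ∈ l.toFinset, Y j ω) = ∑ j ∈ l.toFinset, Y j := by
        ext ω; simp
      have hm : Measurable (∑ j ∈ l.toFinset, Y j) :=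
        e2 ▸ Finset.measurable_sum _ fun j _ => hY j
      have e := h.map_add_eq_map_conv_map (hY i) hm
      rw [e2, ← e]
      congr 1
      ext ω
      rw [List.toFinset_cons, Finset.sum_insert hi']
      simp
  have := key s.toList s.nodup_toList
  rwa [Finset.toList_toFinset] at this

/-- Convolving with the law of the independent remaining sum averages atoms, so it cannot raise
their maximum. -/
lemma real_sum_eq_le_of_subset (hY : ∀ i, Measurable (Y i)) (hind : iIndepFun Y P)
    {B s : Finset ι} (hB : B ⊆ s) {M : ℝ} (hM : ∀ y, P.real {ω | ∑ i ∈ B, Y i ω = y} ≤ M)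
    (x : ℝ) : P.real {ω | ∑ i ∈ s, Y i ω = x} ≤ M := by
  classical
  have h := hind.indepFun_finset (s \ B) B Finset.sdiff_disjoint hY
  have h2 := h.comp (φ := fun v : (↥(s \ B) → ℝ) => ∑ i, v i) (ψ := fun v : (↥B → ℝ) => ∑ i, v i)
    (by fun_prop) (by fun_prop)
  have e1 : ((fun v : (↥(s \ B) → ℝ) => ∑ i, v i) ∘ fun a (i : ↥(s \ B)) => Y i a) =
      fun ω => ∑ i ∈ s \ B, Y i ω := by
    ext ω; exact Finset.sum_coe_sort (s \ B) fun i => Y i ω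
  have e2 : ((fun v : (↥B → ℝ) => ∑ i, v i) ∘ fun a (i : ↥B) => Y i a) =
      fun ω => ∑ i ∈ B, Y i ω := by
    ext ω; exact Finset.sum_coe_sort B fun i => Y i ω
  rw [e1, e2] at h2
  have m1 : Measurable fun ω => ∑ i ∈ s \ B, Y i ω := Finset.measurable_sum _ fun j _ => hY j
  have m2 : Measurable fun ω => ∑ i ∈ B, Y i ω := Finset.measurable_sum _ fun j _ => hY j
  have e := h2.map_add_eq_map_conv_map m1 m2
  have e3 : (fun ω => ∑ i ∈ s, Y i ω) =
      (fun ω => ∑ i ∈ s \ B, Y i ω) + fun ω => ∑ i ∈ B, Y i ω := by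
    ext ω; exact (Finset.sum_sdiff hB).symm
  have := Measure.isProbabilityMeasure_map (μ := P) m1.aemeasurable
  have := Measure.isProbabilityMeasure_map (μ := P) m2.aemeasurable
  rw [real_sum_eq_eq_map hY, e3, e]
  refine conv_real_singleton_le _ _ (fun y => ?_) x
  rw [← real_sum_eq_eq_map hY]
  exact hM y

lemma real_sum_eq_le_of_atoms_le (hY : ∀ i, Measurable (Y i)) (hind : iIndepFun Y P)
    {s : Finset ι} (hs : s.Nonempty) (r : ℕ)
    (hat : ∀ i ∈ s, biggestJump (P.map (Y i)) ≤ 1 / 2 ^ (r + 1)) (x : ℝ) :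
    P.real {ω | ∑ i ∈ s, Y i ω = x} ≤ 4 * (1 / 2 ^ (r + 1)) / √(s.card + 1) := by
  have hp : ∀ i, IsProbabilityMeasure (P.map (Y i)) := fun i =>
    Measure.isProbabilityMeasure_map (hY i).aemeasurable
  rw [real_sum_eq_eq_map hY, map_sum_eq_convList hY hind]
  have := convList_real_singleton_le r (s.toList.map fun i => P.map (Y i))
    (by simpa using hs.ne_empty) (by simpa using fun i _ => hp i) (by
      intro μ hμ y
      obtain ⟨i, hi, rfl⟩ := List.mem_map.1 hμ
      exact (real_singleton_le_biggestJump _ y).trans (hat i (Finset.mem_toList.1 hi))) x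
  simpa using this

lemma real_sum_eq_le_of_large_atoms (hY : ∀ i, Measurable (Y i)) (hind : iIndepFun Y P)
    {s : Finset ι} (hhalf : ∀ i ∈ s, 1 / 2 ≤ biggestJump (P.map (Y i)))
    (hlt : ∀ i ∈ s, biggestJump (P.map (Y i)) < 1)
    (hat : ∀ i ∈ s, ∃ a, (P.map (Y i)).real {a} = biggestJump (P.map (Y i))) (x : ℝ) :
    P.real {ω | ∑ i ∈ s, Y i ω = x} ≤
      2 / √(1 + ∑ i ∈ s, (1 - biggestJump (P.map (Y i))) / 2) := by
  have hp : ∀ i, IsProbabilityMeasure (P.map (Y i)) := fun i =>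
    Measure.isProbabilityMeasure_map (hY i).aemeasurable
  have hL : ∀ μ ∈ s.toList.map fun i => P.map (Y i), IsProbabilityMeasure μ := by
    simpa using fun i _ => hp i
  rw [real_sum_eq_eq_map hY, map_sum_eq_convList hY hind]
  have := isProbabilityMeasure_convList hL
  have := conv_convList_real_singleton_le (s.toList.map fun i => P.map (Y i)) [] hL (by
      intro μ hμ
      obtain ⟨i, hi, rfl⟩ := List.mem_map.1 hμ
      rw [Finset.mem_toList] at hi
      exact ⟨hhalf i hi, hlt i hi, hat i hi⟩) (by simp) (by simp) x
  simpa [convList, Function.comp_def] using this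

lemma real_sum_eq_le_biggestJump (hY : ∀ i, Measurable (Y i)) (hind : iIndepFun Y P)
    {s : Finset ι} {i : ι} (hi : i ∈ s) (x : ℝ) :
    P.real {ω | ∑ i ∈ s, Y i ω = x} ≤ biggestJump (P.map (Y i)) := by
  have := Measure.isProbabilityMeasure_map (μ := P) (hY i).aemeasurable
  refine real_sum_eq_le_of_subset hY hind (Finset.singleton_subset_iff.2 hi) (fun y => ?_) x
  simp only [Finset.sum_singleton]
  refine le_trans (le_of_eq ?_) (real_singleton_le_biggestJump _ y)
  rw [map_measureReal_apply (hY i) (measurableSet_singleton y)]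
  rfl

end SumLaw

/-! ### The linear concentration inequality -/

lemma rpow_three_halves {x : ℝ} (hx : 0 ≤ x) : x ^ (3 / 2 : ℝ) = x * √x := by
  rw [Real.sqrt_eq_rpow, ← Real.rpow_one_add' hx (by norm_num)]
  norm_num

lemma linearBound_nonneg {ι : Type*} {s : Finset ι} {κ κΔ : ι → ℝ} (h1 : ∀ i ∈ s, κ i ≤ 1)
    (h2 : ∀ i ∈ s, 0 ≤ κΔ i) (h3 : ∀ i ∈ s, κΔ i ≤ 1) : 0 ≤ linearBound s κ κΔ :=
  div_nonneg (Finset.sum_nonneg fun i hi => mul_nonneg (sub_nonneg.2 (h1 i hi)) (h2 i hi))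
    (Real.rpow_nonneg (Finset.sum_nonneg fun i hi => sub_nonneg.2 (h3 i hi)) _)

lemma linearBound_mono {ι : Type*} {s : Finset ι} (hs : s.Nonempty) {κ κΔ : ι → ℝ}
    (h0 : ∀ i ∈ s, 0 ≤ κ i) (hle : ∀ i ∈ s, κ i ≤ κΔ i) (hlt : ∀ i ∈ s, κΔ i < 1) :
    linearBound s κ κ ≤ linearBound s κ κΔ := by
  have hpos : 0 < ∑ i ∈ s, (1 - κΔ i) := Finset.sum_pos (fun i hi => sub_pos.2 (hlt i hi)) hs
  have hκ : ∀ i ∈ s, 0 ≤ 1 - κ i := fun i hi => by linarith [hle i hi, hlt i hi]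
  unfold linearBound
  refine div_le_div₀ ?_ ?_ (Real.rpow_pos_of_pos hpos _) ?_
  · exact Finset.sum_nonneg fun i hi => mul_nonneg (hκ i hi) ((h0 i hi).trans (hle i hi))
  · exact Finset.sum_le_sum fun i hi => mul_le_mul_of_nonneg_left (hle i hi) (hκ i hi)
  · refine Real.rpow_le_rpow hpos.le (Finset.sum_le_sum fun i hi => ?_) (by norm_num)
    linarith [hle i hi]

/-- Kesten's concentration inequality for the atoms of a sum of independent variables. -/
theorem real_sum_eq_le_linearBound {ι Ω : Type*} [MeasurableSpace Ω] {P : Measure Ω}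
    [IsProbabilityMeasure P] {Y : ι → Ω → ℝ} (hY : ∀ i, Measurable (Y i)) (hind : iIndepFun Y P)
    {s : Finset ι} (hs : s.Nonempty) {κ : ι → ℝ} (hκ : ∀ i ∈ s, biggestJump (P.map (Y i)) = κ i)
    (hlt : ∀ i ∈ s, κ i < 1) (hat : ∀ i ∈ s, ∃ a, (P.map (Y i)).real {a} = κ i) (x : ℝ) :
    P.real {ω | ∑ i ∈ s, Y i ω = x} ≤ 128 * linearBound s κ κ := by
  classical
  have h0 : ∀ i ∈ s, 0 ≤ κ i := fun i hi => hκ i hi ▸ biggestJump_nonneg _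
  set W := ∑ i ∈ s, (1 - κ i) with hW
  set N := ∑ i ∈ s, (1 - κ i) * κ i with hN
  have hterm : ∀ i ∈ s, 0 ≤ (1 - κ i) * κ i := fun i hi =>
    mul_nonneg (sub_nonneg.2 (hlt i hi).le) (h0 i hi)
  have hW0 : 0 < W := Finset.sum_pos (fun i hi => sub_pos.2 (hlt i hi)) hs
  have hbound : linearBound s κ κ = N / (W * √W) := by
    rw [linearBound, rpow_three_halves hW0.le]
  rw [hbound]
  set A := s.filter fun i => 1 / 2 ≤ κ i with hA
  set B := s.filter fun i => ¬ 1 / 2 ≤ κ i with hB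
  have hAs : A ⊆ s := Finset.filter_subset _ _
  have hBs : B ⊆ s := Finset.filter_subset _ _
  have hAm : ∀ i ∈ A, 1 / 2 ≤ κ i := fun i hi => (Finset.mem_filter.1 hi).2
  have hBm : ∀ i ∈ B, κ i < 1 / 2 := fun i hi => not_le.1 (Finset.mem_filter.1 hi).2
  have hWAB : ∑ i ∈ A, (1 - κ i) + ∑ i ∈ B, (1 - κ i) = W :=
    Finset.sum_filter_add_sum_filter_not s _ _
  have hsW : 0 < √W := Real.sqrt_pos.2 hW0
  by_cases hcase : W / 2 ≤ ∑ i ∈ A, (1 - κ i)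
  · have h1 := real_sum_eq_le_of_subset hY hind hAs
      (real_sum_eq_le_of_large_atoms hY hind (s := A)
        (fun i hi => (hκ i (hAs hi)).symm ▸ hAm i hi)
        (fun i hi => (hκ i (hAs hi)).symm ▸ hlt i (hAs hi))
        (fun i hi => (hκ i (hAs hi)).symm ▸ hat i (hAs hi))) x
    have hsum : ∑ i ∈ A, (1 - biggestJump (P.map (Y i))) / 2 = (∑ i ∈ A, (1 - κ i)) / 2 := by
      rw [Finset.sum_div]
      exact Finset.sum_congr rfl fun i hi => by rw [hκ i (hAs hi)]
    rw [hsum] at h1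
    refine h1.trans ?_
    -- On `A` the factor `κ i` is at least `1/2`, so `N` is comparable to `W` and the target is of
    -- order `1 / √W`.
    have hNW : W / 4 ≤ N := by
      calc W / 4 ≤ ∑ i ∈ A, (1 - κ i) * (1 / 2) := by rw [← Finset.sum_mul]; linarith
        _ ≤ ∑ i ∈ A, (1 - κ i) * κ i := Finset.sum_le_sum fun i hi =>
            mul_le_mul_of_nonneg_left (hAm i hi) (sub_nonneg.2 (hlt i (hAs hi)).le)
        _ ≤ N := Finset.sum_le_sum_of_subset_of_nonneg hAs fun i hi _ => hterm i hi
    have h4 : √W / 2 ≤ √(1 + (∑ i ∈ A, (1 - κ i)) / 2) := by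
      refine Real.le_sqrt_of_sq_le ?_
      rw [div_pow, Real.sq_sqrt hW0.le]
      linarith
    calc 2 / √(1 + (∑ i ∈ A, (1 - κ i)) / 2) ≤ 2 / (√W / 2) := by gcongr
      _ = 16 * ((W / 4) / (W * √W)) := by field_simp; norm_num
      _ ≤ 128 * (N / (W * √W)) := by gcongr; norm_num
  · have hWB : W / 2 ≤ ∑ i ∈ B, (1 - κ i) := by linarith
    have hBne : B.Nonempty := by
      by_contra h
      rw [Finset.not_nonempty_iff_eq_empty] at h
      rw [h, Finset.sum_empty] at hWB
      linarith
    set b : ℝ := (B.card : ℝ) with hb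
    have hb0 : 0 < b := by rw [hb]; exact_mod_cast hBne.card_pos
    have hWb : W ≤ 2 * b := by
      have : ∑ i ∈ B, (1 - κ i) ≤ ∑ i ∈ B, (1 : ℝ) :=
        Finset.sum_le_sum fun i hi => by linarith [h0 i (hBs hi)]
      rw [Finset.sum_const, nsmul_eq_mul, mul_one] at this
      linarith
    set K := ∑ i ∈ B, κ i with hK
    have hK0 : 0 ≤ K := Finset.sum_nonneg fun i hi => h0 i (hBs hi)
    have hNK : K / 2 ≤ N := by
      calc K / 2 = ∑ i ∈ B, (1 / 2) * κ i := by rw [← Finset.mul_sum]; ring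
        _ ≤ ∑ i ∈ B, (1 - κ i) * κ i := Finset.sum_le_sum fun i hi =>
            mul_le_mul_of_nonneg_right (by linarith [hBm i hi]) (h0 i (hBs hi))
        _ ≤ N := Finset.sum_le_sum_of_subset_of_nonneg hBs fun i hi _ => hterm i hi
    -- If `K = 0`, some variable has no atoms, and the probability vanishes.
    rcases hK0.eq_or_lt with hK' | hKpos
    · obtain ⟨i, hi⟩ := hBne
      have hi0 : κ i = 0 :=
        (Finset.sum_eq_zero_iff_of_nonneg fun i hi => h0 i (hBs hi)).1 hK'.symm i hi
      refine (real_sum_eq_le_biggestJump hY hind (hBs hi) x).trans ?_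
      rw [hκ i (hBs hi), hi0]
      have : 0 ≤ N := Finset.sum_nonneg hterm
      positivity
    -- The cap at `1/2` gives `2 * k ≤ 1`, so a dyadic level `r` exists with `k ≤ 2 ^ (-(r + 1)) < 2
    -- * k`.
    set k := min (2 * K / b) (1 / 2) with hk
    have hk0 : 0 < k := lt_min (by positivity) (by norm_num)
    obtain ⟨r, hr1, hr2⟩ := exists_nat_pow_near_of_lt_one (x := 2 * k) (y := (1 / 2 : ℝ))
      (by positivity) (by linarith [min_le_right (2 * K / b) (1 / 2 : ℝ)]) (by norm_num)
      (by norm_num)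
    -- By Markov, at least half of the indices in `B` have `κ` at most twice its mean over `B`.
    set B' := B.filter fun i => κ i ≤ 2 * K / b with hB'
    have hB'B : B' ⊆ B := Finset.filter_subset _ _
    have hcard : b / 2 ≤ B'.card := by
      have h1 : ((B.filter fun i => ¬ κ i ≤ 2 * K / b).card : ℝ) * (2 * K / b) ≤ K := by
        rw [← nsmul_eq_mul]
        refine (Finset.card_nsmul_le_sum _ κ _ fun i hi =>
          (not_le.1 (Finset.mem_filter.1 hi).2).le).trans ?_
        exact Finset.sum_le_sum_of_subset_of_nonneg (Finset.filter_subset _ _)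
          fun i hi _ => h0 i (hBs hi)
      have h2 : (B'.card : ℝ) + (B.filter fun i => ¬ κ i ≤ 2 * K / b).card = b := by
        rw [hb, hB', ← Nat.cast_add, Finset.card_filter_add_card_filter_not]
      have h3 : ((B.filter fun i => ¬ κ i ≤ 2 * K / b).card : ℝ) ≤ b / 2 := by
        rw [mul_div_assoc', div_le_iff₀ hb0] at h1
        nlinarith
      linarith
    have hB'ne : B'.Nonempty := by
      rw [← Finset.card_pos]
      have : (0 : ℝ) < B'.card := by linarith
      exact_mod_cast this
    have h1 := real_sum_eq_le_of_subset hY hind (hB'B.trans hBs)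
      (real_sum_eq_le_of_atoms_le hY hind hB'ne r (by
        intro i hi
        rw [hκ i (hBs (hB'B hi)), ← one_div_pow]
        have : κ i ≤ k := le_min (Finset.mem_filter.1 hi).2 (hBm i (hB'B hi)).le
        rw [pow_succ]
        linarith)) x
    refine h1.trans ?_
    rw [← one_div_pow]
    have hk2 : (1 / 2 : ℝ) ^ (r + 1) ≤ 2 * (2 * K / b) :=
      hr1.le.trans (by linarith [min_le_left (2 * K / b) (1 / 2 : ℝ)])
    set q := √(b / 2) with hq
    have hq0 : 0 < q := Real.sqrt_pos.2 (by positivity)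
    have hqW : √W ≤ 2 * q := by
      refine Real.sqrt_le_iff.2 ⟨by positivity, ?_⟩
      rw [mul_pow, hq, Real.sq_sqrt (by positivity)]
      linarith
    calc 4 * (1 / 2 : ℝ) ^ (r + 1) / √(B'.card + 1)
        ≤ 4 * (2 * (2 * K / b)) / q := by
          gcongr
          exact Real.sqrt_le_sqrt (by linarith)
      _ = 128 * ((K / 2) / (2 * b * (2 * q))) := by field_simp; norm_num
      _ ≤ 128 * (N / (W * √W)) := by
          gcongr
          exact (by positivity : 0 ≤ K / 2).trans hNK

lemma IsJumpLevel.spec {μ : Measure ℝ} {k : ℝ} (h : IsJumpLevel μ k) :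
    biggestJump μ ≤ k ∧ k < 1 ∧ ∃ a, μ.real {a} = biggestJump μ := by
  obtain ⟨hk, x, Δ, hx, hΔ, _, rfl⟩ := h
  refine ⟨?_, hk, x, hx⟩
  unfold jumpLevel
  split_ifs <;> linarith

/-! ### Linear forms in independent variables -/

lemma map_mul_left_real_singleton (μ : Measure ℝ) {b : ℝ} (hb : b ≠ 0) (x : ℝ) :
    (μ.map fun t => b * t).real {x} = μ.real {x / b} := by
  rw [map_measureReal_apply (by fun_prop) (measurableSet_singleton x)]
  congr 1
  ext t
  simp only [Set.mem_preimage, Set.mem_singleton_iff]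
  rw [eq_div_iff hb, mul_comm]

lemma biggestJump_map_mul_left (μ : Measure ℝ) {b : ℝ} (hb : b ≠ 0) :
    biggestJump (μ.map fun t => b * t) = biggestJump μ := by
  unfold biggestJump
  simp only [map_mul_left_real_singleton μ hb]
  exact (Equiv.divRight₀ b hb).iSup_comp (g := fun x => μ.real {x})

/-- The concentration inequality for a linear form with non-zero coefficients in independent
variables. -/
lemma real_linear_form_eq_le {ι : Type*} [Fintype ι] {E : ι → Type*}
    [∀ i, MeasurableSpace (E i)] (ν : ∀ i, Measure (E i)) [∀ i, IsProbabilityMeasure (ν i)]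
    {X : ∀ i, E i → ℝ} (hX : ∀ i, Measurable (X i)) {s : Finset ι} (hs : s.Nonempty) {κΔ : ι → ℝ}
    (hκ : ∀ i, IsJumpLevel ((ν i).map (X i)) (κΔ i)) {b : ι → ℝ} (hb : ∀ i ∈ s, b i ≠ 0) (x : ℝ) :
    (Measure.pi ν).real {v | ∑ i ∈ s, b i * X i (v i) = x} ≤
      128 * linearBound s (fun i => biggestJump ((ν i).map (X i))) κΔ := by
  have hind : iIndepFun (fun i (v : ∀ i, E i) => b i * X i (v i)) (Measure.pi ν) :=
    iIndepFun_pi (X := fun i t => b i * X i t) fun i => ((hX i).const_mul _).aemeasurable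
  have hlaw : ∀ i, (Measure.pi ν).map (fun v => b i * X i (v i)) =
      ((ν i).map (X i)).map fun t => b i * t := by
    intro i
    rw [Measure.map_map (by fun_prop) (hX i), ← (measurePreserving_eval ν i).map_eq,
      Measure.map_map (by fun_prop) (measurable_pi_apply i)]
    rfl
  have h1 := real_sum_eq_le_linearBound
    (fun i => ((hX i).comp (measurable_pi_apply i)).const_mul (b i)) hind hs
    (κ := fun i => biggestJump ((ν i).map (X i)))
    (fun i hi => by
      simp only [Function.comp_apply]
      rw [hlaw, biggestJump_map_mul_left _ (hb i hi)])
    (fun i _ => (hκ i).spec.1.trans_lt (hκ i).spec.2.1)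
    (fun i hi => by
      obtain ⟨a, ha⟩ := (hκ i).spec.2.2
      refine ⟨b i * a, ?_⟩
      simp only [Function.comp_apply]
      rw [hlaw, map_mul_left_real_singleton _ (hb i hi), mul_div_cancel_left₀ _ (hb i hi), ha]) x
  refine h1.trans ?_
  gcongr
  exact linearBound_mono hs (fun i _ => biggestJump_nonneg _) (fun i _ => (hκ i).spec.1)
    fun i _ => (hκ i).spec.2.1

/-! ### Decoupling and the quadratic form -/

/-- Decoupling: the square of a probability is at most the probability that the event holds for
two independent copies of the second variable. -/
lemma sq_prod_real_le {α β : Type*} [MeasurableSpace α] [MeasurableSpace β] (μ : Measure α)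
    (ν : Measure β) [IsProbabilityMeasure μ] [IsProbabilityMeasure ν] {E : Set (α × β)}
    (hE : MeasurableSet E) :
    ((μ.prod ν).real E) ^ 2 ≤
      (μ.prod (ν.prod ν)).real {q | (q.1, q.2.1) ∈ E ∧ (q.1, q.2.2) ∈ E} := by
  set g : α → ℝ := fun a => ν.real (Prod.mk a ⁻¹' E) with hg
  have hgm : Measurable g := (measurable_measure_prodMk_left hE).ennreal_toReal
  have hg0 : ∀ a, 0 ≤ g a := fun a => measureReal_nonneg
  have hg1 : ∀ a, g a ≤ 1 := fun a => measureReal_le_one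
  have hgi : Integrable g μ := Integrable.of_bound (C := 1) hgm.aestronglyMeasurable
    (ae_of_all _ fun a => by rw [Real.norm_of_nonneg (hg0 a)]; exact hg1 a)
  have hg2i : Integrable (fun a => g a ^ 2) μ :=
    Integrable.of_bound (C := 1) (hgm.pow_const 2).aestronglyMeasurable
      (ae_of_all _ fun a => by
        rw [Real.norm_of_nonneg (sq_nonneg _)]; exact pow_le_one₀ (hg0 a) (hg1 a))
  have e1 : (μ.prod ν).real E = ∫ a, g a ∂μ := by
    rw [measureReal_def, Measure.prod_apply hE, ← integral_toReal]
    · rfl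
    · exact (measurable_measure_prodMk_left hE).aemeasurable
    · exact ae_of_all _ fun x => measure_lt_top _ _
  have hE2 : MeasurableSet {q : α × β × β | (q.1, q.2.1) ∈ E ∧ (q.1, q.2.2) ∈ E} :=
    (hE.preimage (by fun_prop : Measurable fun q : α × β × β => (q.1, q.2.1))).inter
      (hE.preimage (by fun_prop : Measurable fun q : α × β × β => (q.1, q.2.2)))
  have e2 : (μ.prod (ν.prod ν)).real {q | (q.1, q.2.1) ∈ E ∧ (q.1, q.2.2) ∈ E} =
      ∫ a, g a ^ 2 ∂μ := by
    rw [measureReal_def, Measure.prod_apply hE2, ← integral_toReal]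
    · refine integral_congr_ae (ae_of_all _ fun a => ?_)
      have : Prod.mk a ⁻¹' {q : α × β × β | (q.1, q.2.1) ∈ E ∧ (q.1, q.2.2) ∈ E} =
          (Prod.mk a ⁻¹' E) ×ˢ (Prod.mk a ⁻¹' E) := by
        ext q; simp
      dsimp only
      rw [this, Measure.prod_prod, ENNReal.toReal_mul, sq]
      rfl
    · exact (measurable_measure_prodMk_left hE2).aemeasurable
    · exact ae_of_all _ fun x => measure_lt_top _ _
  rw [e1, e2]
  set p := ∫ a, g a ∂μ with hp
  -- Jensen's inequality, as non-negativity of the variance of the section measure `g`.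
  have h : 0 ≤ ∫ a, (g a - p) ^ 2 ∂μ := integral_nonneg fun a => sq_nonneg _
  have h' : ∫ a, (g a - p) ^ 2 ∂μ = ∫ a, g a ^ 2 ∂μ - p ^ 2 := by
    have : ∀ a, (g a - p) ^ 2 = g a ^ 2 - (2 * p * g a - p ^ 2) := fun a => by ring
    simp only [this]
    have hi := (hgi.const_mul (2 * p))
    have hi2 : Integrable (fun a => 2 * p * g a - p ^ 2) μ := hi.sub (integrable_const _)
    rw [integral_sub hg2i hi2, integral_sub hi (integrable_const _), integral_const_mul, ← hp]
    simp
    ring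
  linarith

/-- Fubini, with the sections over `G` bounded trivially by one. -/
lemma prod_real_le_of_sections_le {α β : Type*} [MeasurableSpace α] [MeasurableSpace β]
    (μ : Measure α) (ρ : Measure β) [IsProbabilityMeasure μ] [IsProbabilityMeasure ρ]
    {F : Set (α × β)} (hF : MeasurableSet F) {G : Set β} (hG : MeasurableSet G) {M : ℝ}
    (hM0 : 0 ≤ M) (hM : ∀ y ∉ G, μ.real {a | (a, y) ∈ F} ≤ M) :
    (μ.prod ρ).real F ≤ ρ.real G + M := by
  have hm : Measurable fun y => μ {a | (a, y) ∈ F} := measurable_measure_prodMk_right hF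
  have e : (μ.prod ρ).real F = ∫ y, μ.real {a | (a, y) ∈ F} ∂ρ := by
    rw [measureReal_def, Measure.prod_apply_symm hF, ← integral_toReal]
    · rfl
    · exact hm.aemeasurable
    · exact ae_of_all _ fun x => measure_lt_top _ _
  have hi : Integrable (fun y => μ.real {a | (a, y) ∈ F}) ρ :=
    Integrable.of_bound (C := 1) hm.ennreal_toReal.aestronglyMeasurable
      (ae_of_all _ fun a => by
        rw [Real.norm_of_nonneg measureReal_nonneg]; exact measureReal_le_one)
  have hGi : Integrable (G.indicator fun _ => (1 : ℝ)) ρ := (integrable_const _).indicator hG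
  rw [e]
  calc ∫ y, μ.real {a | (a, y) ∈ F} ∂ρ
      ≤ ∫ y, (G.indicator (fun _ => (1 : ℝ)) y + M) ∂ρ := by
        refine integral_mono hi (hGi.add (integrable_const _)) fun y => ?_
        by_cases hy : y ∈ G
        · simp only [Set.indicator_of_mem hy]
          exact measureReal_le_one.trans (by linarith)
        · simp only [Set.indicator_of_notMem hy, zero_add]
          exact hM y hy
    _ = ρ.real G + M := by
        rw [integral_add hGi (integrable_const _), integral_indicator_const _ hG]
        simp

/-- The vector that agrees with `z` on `S` and with `w` off `S`. -/
noncomputable def glue {n : ℕ} (S : Finset (Fin n)) (z w : Fin n → ℝ) : Fin n → ℝ :=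
  fun i => if i ∈ S then z i else w i

lemma measurable_glue {n : ℕ} (S : Finset (Fin n)) :
    Measurable fun p : (Fin n → ℝ) × (Fin n → ℝ) => glue S p.2 p.1 := by
  refine measurable_pi_lambda _ fun i => ?_
  unfold glue
  by_cases h : i ∈ S
  · simp only [h, if_true]; fun_prop
  · simp only [h, if_false]; fun_prop

/-- Each coordinate is read from exactly one of two independent copies, so the product law persists.
This allows the `S₁`-block to be resampled without splitting the index type. -/
lemma measurePreserving_glue {n : ℕ} (S : Finset (Fin n)) (μ : Fin n → Measure ℝ)
    [∀ i, IsProbabilityMeasure (μ i)] :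
    MeasurePreserving (fun p : (Fin n → ℝ) × (Fin n → ℝ) => glue S p.2 p.1)
      ((Measure.pi μ).prod (Measure.pi μ)) (Measure.pi μ) := by
  refine ⟨measurable_glue S, (Measure.pi_eq fun s hs => ?_).symm⟩
  rw [Measure.map_apply (measurable_glue S) (MeasurableSet.univ_pi hs)]
  have : (fun p : (Fin n → ℝ) × (Fin n → ℝ) => glue S p.2 p.1) ⁻¹' (Set.univ.pi s) =
      (Set.univ.pi fun i => if i ∈ S then Set.univ else s i) ×ˢ
        (Set.univ.pi fun i => if i ∈ S then s i else Set.univ) := by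
    ext p
    simp only [Set.mem_preimage, Set.mem_pi, Set.mem_univ, true_imp_iff, Set.mem_prod, glue]
    rw [← forall_and]
    refine forall_congr' fun i => ?_
    by_cases h : i ∈ S <;> simp [h]
  rw [this, Measure.prod_prod, Measure.pi_pi, Measure.pi_pi, ← Finset.prod_mul_distrib]
  refine Finset.prod_congr rfl fun i _ => ?_
  by_cases h : i ∈ S <;> simp [h]

/-- Symmetry of `c` merges the two cross blocks into one with factor `2`. -/
lemma quadratic_glue {n : ℕ} {c : Fin n → Fin n → ℝ} (hc : ∀ i j, c i j = c j i)
    {S₁ S₂ : Finset (Fin n)} (hd : Disjoint S₁ S₂) (hu : S₁ ∪ S₂ = Finset.univ)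
    (z w : Fin n → ℝ) :
    ∑ i, ∑ j, c i j * glue S₁ z w i * glue S₁ z w j =
      ∑ i ∈ S₁, ∑ j ∈ S₁, c i j * z i * z j + ∑ i ∈ S₂, ∑ j ∈ S₂, c i j * w i * w j +
        ∑ j ∈ S₂, 2 * (∑ i ∈ nbhd c S₁ j, c i j * z i) * w j := by
  have h1 : ∀ i ∈ S₁, glue S₁ z w i = z i := fun i hi => if_pos hi
  have h2 : ∀ i ∈ S₂, glue S₁ z w i = w i := fun i hi =>
    if_neg fun h => Finset.disjoint_left.1 hd h hi
  have split : ∀ f : Fin n → ℝ, ∑ i, f i = ∑ i ∈ S₁, f i + ∑ i ∈ S₂, f i := fun f => by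
    rw [← hu, Finset.sum_union hd]
  have h3 : ∀ j, ∑ i ∈ nbhd c S₁ j, c i j * z i = ∑ i ∈ S₁, c i j * z i := fun j => by
    rw [nbhd, Finset.sum_filter]
    refine Finset.sum_congr rfl fun i _ => ?_
    split_ifs with h
    · rfl
    · rw [not_not.1 h, zero_mul]
  simp only [split, h3]
  rw [Finset.sum_add_distrib, Finset.sum_add_distrib]
  have e11 : ∑ i ∈ S₁, ∑ j ∈ S₁, c i j * glue S₁ z w i * glue S₁ z w j =
      ∑ i ∈ S₁, ∑ j ∈ S₁, c i j * z i * z j :=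
    Finset.sum_congr rfl fun i hi => Finset.sum_congr rfl fun j hj => by rw [h1 i hi, h1 j hj]
  have e22 : ∑ i ∈ S₂, ∑ j ∈ S₂, c i j * glue S₁ z w i * glue S₁ z w j =
      ∑ i ∈ S₂, ∑ j ∈ S₂, c i j * w i * w j :=
    Finset.sum_congr rfl fun i hi => Finset.sum_congr rfl fun j hj => by rw [h2 i hi, h2 j hj]
  have e12 : ∑ i ∈ S₁, ∑ j ∈ S₂, c i j * glue S₁ z w i * glue S₁ z w j =
      ∑ j ∈ S₂, (∑ i ∈ S₁, c i j * z i) * w j := by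
    rw [Finset.sum_comm]
    refine Finset.sum_congr rfl fun j hj => ?_
    rw [Finset.sum_mul]
    exact Finset.sum_congr rfl fun i hi => by rw [h1 i hi, h2 j hj]
  have e21 : ∑ i ∈ S₂, ∑ j ∈ S₁, c i j * glue S₁ z w i * glue S₁ z w j =
      ∑ j ∈ S₂, (∑ i ∈ S₁, c i j * z i) * w j := by
    refine Finset.sum_congr rfl fun j hj => ?_
    rw [Finset.sum_mul]
    exact Finset.sum_congr rfl fun i hi => by rw [h1 i hi, h2 j hj, hc j i]; ring
  rw [e11, e12, e21, e22]
  have : ∑ j ∈ S₂, 2 * (∑ i ∈ S₁, c i j * z i) * w j =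
      2 * ∑ j ∈ S₂, (∑ i ∈ S₁, c i j * z i) * w j := by
    rw [Finset.mul_sum]
    exact Finset.sum_congr rfl fun j _ => by ring
  rw [this]
  ring

/-- Regrouped coordinatewise, the two copies form independent pairs with laws `μ i × μ i`, and the
differences of the pairs have the symmetrized laws. -/
lemma real_symmetrized_form_eq_zero_le {n : ℕ} (μ : Fin n → Measure ℝ)
    [∀ i, IsProbabilityMeasure (μ i)] {κbarΔ : Fin n → ℝ}
    (hκ : ∀ i, IsJumpLevel (symmetrizedLaw (μ i)) (κbarΔ i)) {s : Finset (Fin n)}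
    (hs : s.Nonempty) {b : Fin n → ℝ} (hb : ∀ i ∈ s, b i ≠ 0) :
    ((Measure.pi μ).prod (Measure.pi μ)).real {y | ∑ i ∈ s, b i * (y.1 i - y.2 i) = 0} ≤
      128 * linearBound s (fun i => biggestJump (symmetrizedLaw (μ i))) κbarΔ := by
  have hX : ∀ i : Fin n, Measurable fun p : ℝ × ℝ => p.1 - p.2 := fun _ => by fun_prop
  have h := real_linear_form_eq_le (fun i => (μ i).prod (μ i)) hX hs hκ hb 0
  have hmp := measurePreserving_arrowProdEquivProdArrow ℝ ℝ (Fin n) μ μ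
  have hm : MeasurableSet {y : (Fin n → ℝ) × (Fin n → ℝ) |
      ∑ i ∈ s, b i * (y.1 i - y.2 i) = 0} :=
    measurableSet_eq_fun (by fun_prop) measurable_const
  rw [← hmp.map_eq, map_measureReal_apply hmp.measurable hm]
  exact h

/-- The quadratic concentration inequality for a product measure. -/
lemma pi_real_quadratic_eq_sq_le {n : ℕ} (μ : Fin n → Measure ℝ)
    [∀ i, IsProbabilityMeasure (μ i)] {c : Fin n → Fin n → ℝ} (hc : ∀ i j, c i j = c j i)
    {S₁ S₂ : Finset (Fin n)} (hd : Disjoint S₁ S₂) (hu : S₁ ∪ S₂ = Finset.univ)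
    (hS₂ : S₂.Nonempty) (hN : ∀ j ∈ S₂, (nbhd c S₁ j).Nonempty) {κΔ κbarΔ : Fin n → ℝ}
    (hκ : ∀ i, IsJumpLevel (μ i) (κΔ i))
    (hκbar : ∀ i, IsJumpLevel (symmetrizedLaw (μ i)) (κbarΔ i)) (x : ℝ) :
    (Measure.pi μ).real {z | ∑ i, ∑ j, c i j * z i * z j = x} ^ 2 ≤
      256 * ((1 / (S₂.card : ℝ)) *
          ∑ j ∈ S₂, linearBound (nbhd c S₁ j) (fun i => biggestJump (symmetrizedLaw (μ i))) κbarΔ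
        + ⨆ D : {D : Finset (Fin n) // D ⊆ S₂ ∧ (S₂.card : ℝ) / 2 ≤ (D.card : ℝ)},
            linearBound D.1 (fun j => biggestJump (μ j)) κΔ) := by
  classical
  set π := Measure.pi μ with hπ
  set m : ℝ := (S₂.card : ℝ) with hm
  have hm0 : 0 < m := by rw [hm]; exact_mod_cast hS₂.card_pos
  set sup := ⨆ D : {D : Finset (Fin n) // D ⊆ S₂ ∧ m / 2 ≤ (D.card : ℝ)},
    linearBound D.1 (fun j => biggestJump (μ j)) κΔ with hsup
  set lb := fun j => linearBound (nbhd c S₁ j)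
    (fun i => biggestJump (symmetrizedLaw (μ i))) κbarΔ with hlb
  have hlevel : ∀ i, 0 ≤ κΔ i := fun i => (biggestJump_nonneg _).trans (hκ i).spec.1
  have hlinear0 : ∀ D : Finset (Fin n), 0 ≤ linearBound D (fun j => biggestJump (μ j)) κΔ :=
    fun D => linearBound_nonneg
      (fun i _ => (hκ i).spec.1.trans (hκ i).spec.2.1.le) (fun i _ => hlevel i)
      fun i _ => (hκ i).spec.2.1.le
  have hsup0 : 0 ≤ sup := Real.iSup_nonneg fun D => hlinear0 D.1
  let a : Fin n → (Fin n → ℝ) × (Fin n → ℝ) → ℝ :=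
    fun j y => ∑ i ∈ nbhd c S₁ j, c i j * (y.1 i - y.2 i)
  have ham : ∀ j, Measurable (a j) := fun j => by fun_prop
  have hQm : Measurable fun z : Fin n → ℝ => ∑ i, ∑ j, c i j * z i * z j := by fun_prop
  -- decoupling
  have hglue : MeasurePreserving _ (π.prod π) π := measurePreserving_glue S₁ μ
  have hE : MeasurableSet {p : (Fin n → ℝ) × (Fin n → ℝ) |
      ∑ i, ∑ j, c i j * glue S₁ p.2 p.1 i * glue S₁ p.2 p.1 j = x} :=
    measurableSet_eq_fun (hQm.comp (measurable_glue S₁)) measurable_const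
  have h1 : π.real {z | ∑ i, ∑ j, c i j * z i * z j = x} = (π.prod π).real
      {p | ∑ i, ∑ j, c i j * glue S₁ p.2 p.1 i * glue S₁ p.2 p.1 j = x} := by
    conv_lhs => rw [← hglue.map_eq]
    rw [map_measureReal_apply hglue.measurable (measurableSet_eq_fun hQm measurable_const)]
    rfl
  have h2 := sq_prod_real_le π π hE
  rw [← h1] at h2
  set R : (Fin n → ℝ) × (Fin n → ℝ) → ℝ := fun y =>
    ∑ i ∈ S₁, ∑ j ∈ S₁, c i j * y.2 i * y.2 j - ∑ i ∈ S₁, ∑ j ∈ S₁, c i j * y.1 i * y.1 j with hR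
  set F : Set ((Fin n → ℝ) × ((Fin n → ℝ) × (Fin n → ℝ))) :=
    {q | ∑ j ∈ S₂, 2 * a j q.2 * q.1 j = R q.2} with hF
  have hFm : MeasurableSet F := measurableSet_eq_fun (by fun_prop) (by fun_prop)
  refine h2.trans ((measureReal_mono (s₂ := F) ?_).trans ?_)
  -- Both equations share `w`, so their `S₂ × S₂` blocks cancel on subtraction.
  · rintro ⟨w, z, z'⟩ ⟨e1, e2⟩
    simp only [Set.mem_ofPred_eq] at e1 e2
    rw [quadratic_glue hc hd hu] at e1 e2
    have hsub : ∑ j ∈ S₂, 2 * a j (z, z') * w j =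
        ∑ j ∈ S₂, 2 * (∑ i ∈ nbhd c S₁ j, c i j * z i) * w j -
          ∑ j ∈ S₂, 2 * (∑ i ∈ nbhd c S₁ j, c i j * z' i) * w j := by
      rw [← Finset.sum_sub_distrib]
      refine Finset.sum_congr rfl fun j _ => ?_
      simp only [a, mul_sub, Finset.sum_sub_distrib]
      ring
    simp only [hF, hR, Set.mem_ofPred_eq]
    rw [hsub]
    linarith
  -- few vanishing coefficients
  set f : (Fin n → ℝ) × (Fin n → ℝ) → ℝ := fun y =>
    ∑ j ∈ S₂, {y | a j y = 0}.indicator (fun _ => (1 : ℝ)) y with hf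
  have ham0 : ∀ j, MeasurableSet {y | a j y = 0} := fun j =>
    measurableSet_eq_fun (ham j) measurable_const
  have hfi : ∀ j ∈ S₂, Integrable ({y | a j y = 0}.indicator fun _ => (1 : ℝ)) (π.prod π) :=
    fun j _ => (integrable_const _).indicator (ham0 j)
  have hfm : Measurable f :=
    Finset.measurable_sum _ fun j _ => measurable_const.indicator (ham0 j)
  have hGm : MeasurableSet {y | m / 2 ≤ f y} := measurableSet_le measurable_const hfm
  have hG : (π.prod π).real {y | m / 2 ≤ f y} ≤ 256 * (1 / m * ∑ j ∈ S₂, lb j) := by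
    -- Markov at level `m / 2` for the number `f` of vanishing coefficients; this doubles `128` to
    -- `256`.
    have h3 := mul_meas_ge_le_integral_of_nonneg (μ := π.prod π) (f := f)
      (ae_of_all _ fun y => Finset.sum_nonneg fun j _ =>
        Set.indicator_nonneg (fun _ _ => zero_le_one) _) (integrable_finsetSum _ hfi) (m / 2)
    have h4 : ∫ y, f y ∂(π.prod π) = ∑ j ∈ S₂, (π.prod π).real {y | a j y = 0} := by
      rw [hf, integral_finsetSum _ hfi]
      refine Finset.sum_congr rfl fun j _ => ?_
      rw [integral_indicator_const _ (ham0 j), smul_eq_mul, mul_one]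
    have h5 : ∑ j ∈ S₂, (π.prod π).real {y | a j y = 0} ≤ ∑ j ∈ S₂, 128 * lb j :=
      Finset.sum_le_sum fun j hj => real_symmetrized_form_eq_zero_le μ hκbar (hN j hj)
        fun i hi => (Finset.mem_filter.1 hi).2
    rw [← Finset.mul_sum] at h5
    rw [h4] at h3
    have h6 : (π.prod π).real {y | m / 2 ≤ f y} ≤ (128 * ∑ j ∈ S₂, lb j) / (m / 2) := by
      rw [le_div_iff₀ (by positivity), mul_comm]
      exact h3.trans h5
    refine h6.trans (le_of_eq ?_)
    field_simp
    ring
  -- many non-vanishing coefficients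
  have hsec : ∀ y ∉ {y | m / 2 ≤ f y}, π.real {w | (w, y) ∈ F} ≤ 128 * sup := by
    intro y hy
    set D := S₂.filter fun j => ¬ a j y = 0 with hD
    have hcard : m / 2 ≤ (D.card : ℝ) := by
      have e1 : f y = ((S₂.filter fun j => a j y = 0).card : ℝ) := by
        simp only [hf, Set.indicator_apply, Set.mem_ofPred_eq, Finset.sum_boole]
      have e2 : ((S₂.filter fun j => a j y = 0).card : ℝ) + D.card = m := by
        rw [hm, hD, ← Nat.cast_add, Finset.card_filter_add_card_filter_not]
      have e3 : f y < m / 2 := not_le.1 hy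
      linarith
    have hDne : D.Nonempty := by
      rw [← Finset.card_pos]
      have : (0 : ℝ) < D.card := by linarith
      exact_mod_cast this
    have h7 := real_linear_form_eq_le μ (X := fun _ t => t) (fun _ => measurable_id) hDne
      (κΔ := κΔ) (fun i => by rw [Measure.map_id']; exact hκ i) (b := fun j => 2 * a j y)
      (fun j hj => mul_ne_zero two_ne_zero (Finset.mem_filter.1 hj).2) (R y)
    simp only [Measure.map_id'] at h7
    have h8 : {w | (w, y) ∈ F} = {w | ∑ j ∈ D, 2 * a j y * w j = R y} := by
      ext w
      simp only [hF, Set.mem_ofPred_eq, hD]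
      rw [Finset.sum_filter_of_ne]
      intro j _ hj h0
      exact hj (by rw [h0]; ring)
    rw [h8]
    refine h7.trans ?_
    gcongr
    exact le_ciSup (f := fun D : {D : Finset (Fin n) // D ⊆ S₂ ∧ m / 2 ≤ (D.card : ℝ)} =>
      linearBound D.1 (fun j => biggestJump (μ j)) κΔ) (Set.finite_range _).bddAbove
      ⟨D, Finset.filter_subset _ _, hcard⟩
  have h9 := prod_real_le_of_sections_le π (π.prod π) hFm hGm (by positivity) hsec
  refine h9.trans ?_
  rw [mul_add]
  linarith

theorem mainTheorem3 :
    ∃ C : ℝ, 0 < C ∧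
      ∀ (n : ℕ) (Ω : Type*) [MeasurableSpace Ω] (P : Measure Ω) [IsProbabilityMeasure P]
        (ξ : Fin n → Ω → ℝ) (c : Fin n → Fin n → ℝ) (S₁ S₂ : Finset (Fin n))
        (κΔ κbarΔ : Fin n → ℝ),
        (∀ i, Measurable (ξ i)) →
        iIndepFun ξ P →
        (∀ i, IsNondegenerate P (ξ i)) →
        (∀ i j, c i j = c j i) →
        Disjoint S₁ S₂ → S₁ ∪ S₂ = Finset.univ → S₂.Nonempty →
        (∀ j ∈ S₂, (nbhd c S₁ j).Nonempty) →
        (∀ i, IsJumpLevel (P.map (ξ i)) (κΔ i)) →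
        (∀ i, IsJumpLevel (symmetrizedLaw (P.map (ξ i))) (κbarΔ i)) →
        ∀ x : ℝ,
          P.real {ω | ∑ i, ∑ j, c i j * ξ i ω * ξ j ω = x} ≤
            C * √((1 / (S₂.card : ℝ)) *
                  ∑ j ∈ S₂, linearBound (nbhd c S₁ j)
                    (fun i => biggestJump (symmetrizedLaw (P.map (ξ i)))) κbarΔ
                + ⨆ D : {D : Finset (Fin n) // D ⊆ S₂ ∧ (S₂.card : ℝ) / 2 ≤ (D.card : ℝ)},
                    linearBound D.1 (fun j => biggestJump (P.map (ξ j))) κΔ) := by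
  -- `16 = √256`, from taking the root of the squared bound.
  refine ⟨16, by norm_num, ?_⟩
  intro n Ω _ P _ ξ c S₁ S₂ κΔ κbarΔ hξ hind _ hc hd hu hS₂ hN hκ hκbar x
  have hp : ∀ i, IsProbabilityMeasure (P.map (ξ i)) := fun i =>
    Measure.isProbabilityMeasure_map (hξ i).aemeasurable
  have h := pi_real_quadratic_eq_sq_le (fun i => P.map (ξ i)) hc hd hu hS₂ hN hκ hκbar x
  rw [← hind.map_fun_eq_pi_map fun i => (hξ i).aemeasurable,
    map_measureReal_apply (measurable_pi_lambda _ hξ)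
      (measurableSet_eq_fun (by fun_prop) measurable_const)] at h
  have h' := Real.le_sqrt_of_sq_le h
  rw [Real.sqrt_mul (by norm_num), show (256 : ℝ) = 16 ^ 2 by norm_num,
    Real.sqrt_sq (by norm_num)] at h'
  exact h'
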